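/- In the algebra $M_3(\mathbb{R})$ of real $3\times 3$ matrices, with the commutator $[X,Y]=XY-YX$, let $$A=\begin{pmatrix}0&0&0\\0&2\pi&0\\0&0&1\end{pmatrix},\quad B=\begin{pmatrix}0&0&0\\-2\pi&0&0\\0&0&0\end{pmatrix},\quad C=\begin{pmatrix}0&0&0\\0&0&0\\-1&0&0\end{pmatrix}.$$ Then $[A,B]=2\pi B$, $[A,C]=C$, $[B,C]=0$, so that $\mathfrak g:=\mathrm{span}\{A,B,C\}$ is a Lie subalgebra of $M_3(\mathbb{R})$. For elements $X,Y$ of a real Lie algebra, let $\sum_{n\ge 1}Z_n(X,Y)$ denote the homogeneous Baker-Campbell-Hausdorff (BCH) series, where $$Z_n(X,Y)=\frac1n\sum_{k=1}^n\frac{(-1)^{k+1}}{k}\sum_{\substack{(i_1,j_1),\dots,(i_k,j_k)\in\mathbb{N}^2\setminus\{(0,0)\}\\ i_1+j_1+\cdots+i_k+j_k=n}}\frac{(\mathrm{ad}\,X)^{i_1}(\mathrm{ad}\,Y)^{j_1}\cdots(\mathrm{ad}\,X)^{i_k}(\mathrm{ad}\,Y)^{j_k-1}(Y)}{i_1!\,j_1!\cdots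 i_k!\,j_k!}$$ (when $j_k=0$ the summand is understood to end with $(\mathrm{ad}\,X)^{i_k-1}(X)$). Convergence of the series means convergence of the sequence of its partial sums, and $Z(X,Y)$ denotes the sum when the series converges. Then: 1. The simply connected Lie group $\mathbb G=(\mathbb{R}^3,\cdot)$ with $x\cdot y=(x_1+y_1,\;x_2+e^{2\pi x_1}y_2,\;x_3+e^{x_1}y_3)$ has Lie algebra isomorphic to $\mathfrak g$, and its exponential map $\mathrm{Lie}(\mathbb G)\to\mathbb G$ is a global real-analytic diffeomorphism. 2. The BCH series $\sum_n Z_n(X,Y)$ converges in $\mathfrak g$ for all $(X,Y)$ in a neighbourhood of $(0,0)$ in $\mathfrak g\times\mathfrak g$, and the map $(X,Y)\mapsto Z(X,Y)$ admits an analytic prolongation to the whole of $\mathfrak g\times\mathfrak g$: there is a real-analytic map $P:\mathfrak g\times\mathfrak g\to\mathfrak g$ such that $P(X,Y)=Z(X,Y)$ whenever the BCH series converges at $(X,Y)\in\mathfrak g\times\mathfrak g$. 3. Nevertheless, the BCH series $\sum_n Z_n(A,B)$ does not converge (neither in $\mathfrak g$ nor in $M_3(\mathbb{R})$). -/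

import Mathlib

open Filter Topology
open scoped Matrix Matrix.Norms.L2Operator Manifold ContDiff

/-! ### The homogeneous Baker-Campbell-Hausdorff series -/

section BCH

variable {L : Type*} [LieRing L]

/-- The right-nested bracket `[a₁, [a₂, … [aₘ₋₁, aₘ] … ]]` of a list `[a₁, …, aₘ]`. It is `a₁` for
a list of length one (and `0` for the empty list, which never occurs below). -/
def rightNestedBracket : List L → L
  | [] => 0
  | [a] => a
  | a :: b :: l => ⁅a, rightNestedBracket (b :: l)⁆

/-- The word `X … X Y … Y ⋯ X … X Y … Y`, in which the `r`-th block consists of `i_r` copies of `X`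
followed by `j_r` copies of `Y`, where `p r = (i_r, j_r)`. -/
def bchWord (X Y : L) {k : ℕ} (p : Fin k → ℕ × ℕ) : List L :=
  (List.ofFn fun r => List.replicate (p r).1 X ++ List.replicate (p r).2 Y).flatten

/-- The `k`-tuples `((i₁, j₁), …, (i_k, j_k))` of pairs of natural numbers, all different from
`(0, 0)`, such that `i₁ + j₁ + ⋯ + i_k + j_k = n`. -/
def bchIndex (n k : ℕ) : Finset (Fin k → ℕ × ℕ) :=
  (Fintype.piFinset fun _ : Fin k => Finset.range (n + 1) ×ˢ Finset.range (n + 1)).filter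
    fun p => (∀ r, p r ≠ (0, 0)) ∧ ∑ r, ((p r).1 + (p r).2) = n

variable [LieAlgebra ℝ L]

/-- The homogeneous component `Zₙ(X, Y)` of degree `n` of the BCH series, in Dynkin's form:
`(1/n) ∑ₖ (-1)ᵏ⁺¹/k ∑ (ad X)^{i₁} (ad Y)^{j₁} ⋯ (ad X)^{i_k} (ad Y)^{j_k - 1} (Y) / (i₁! j₁! ⋯ i_k! j_k!)`
(the summands with `j_k = 0` ending with `(ad X)^{i_k - 1} (X)`). -/
noncomputable def bchTerm (n : ℕ) (X Y : L) : L :=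
  (1 / n : ℝ) • ∑ k ∈ Finset.Icc 1 n, ((-1) ^ (k + 1) / k : ℝ) •
    ∑ p ∈ bchIndex n k,
      (1 / ∏ r, (((p r).1.factorial : ℝ) * ((p r).2.factorial : ℝ))) •
        rightNestedBracket (bchWord X Y p)

variable [TopologicalSpace L]

/-- The BCH series `∑_{n ≥ 1} Zₙ(X, Y)` converges to `S`, as a series: the sequence of its partial
sums tends to `S` (absolute or unconditional convergence is not required). -/
def BCHConvergesTo (X Y S : L) : Prop :=
  Tendsto (fun N : ℕ => ∑ n ∈ Finset.Icc 1 N, bchTerm n X Y) atTop (𝓝 S)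

/-- The BCH series `∑_{n ≥ 1} Zₙ(X, Y)` converges. -/
def BCHConverges (X Y : L) : Prop :=
  ∃ S : L, BCHConvergesTo X Y S

end BCH

/-! ### The Lie algebra -/

-- An associative algebra is a Lie algebra under the commutator `⁅x, y⁆ = x * y - y * x`.
attribute [local instance] LieRing.ofAssociativeRing

noncomputable section

def eggA : Matrix (Fin 3) (Fin 3) ℝ :=
  !![0, 0, 0; 0, 2 * Real.pi, 0; 0, 0, 1]

def eggB : Matrix (Fin 3) (Fin 3) ℝ :=
  !![0, 0, 0; -(2 * Real.pi), 0, 0; 0, 0, 0]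

def eggC : Matrix (Fin 3) (Fin 3) ℝ :=
  !![0, 0, 0; 0, 0, 0; -1, 0, 0]

theorem lie_eggA_eggB : ⁅eggA, eggB⁆ = (2 * Real.pi) • eggB := by
  rw [Ring.lie_def]
  ext i j
  fin_cases i <;> fin_cases j <;> simp [eggA, eggB]

theorem lie_eggA_eggC : ⁅eggA, eggC⁆ = eggC := by
  rw [Ring.lie_def]
  ext i j
  fin_cases i <;> fin_cases j <;> simp [eggA, eggC]

theorem lie_eggB_eggC : ⁅eggB, eggC⁆ = 0 := by
  rw [Ring.lie_def]
  ext i j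
  fin_cases i <;> fin_cases j <;> simp [eggB, eggC]

/-- The Lie subalgebra `span {A, B, C}` of `M₃(ℝ)`, with the commutator as bracket. -/
def eggAlgebra : LieSubalgebra ℝ (Matrix (Fin 3) (Fin 3) ℝ) where
  toSubmodule := Submodule.span ℝ {eggA, eggB, eggC}
  lie_mem' := by
    intro x y hx hy
    simp only [AddSubsemigroup.mem_carrier, AddSubmonoid.mem_toSubsemigroup,
      Submodule.mem_toAddSubmonoid] at hx hy ⊢
    have hBA : ⁅eggB, eggA⁆ = -((2 * Real.pi) • eggB) := by rw [← lie_skew, lie_eggA_eggB]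
    have hCA : ⁅eggC, eggA⁆ = -eggC := by rw [← lie_skew, lie_eggA_eggC]
    have hCB : ⁅eggC, eggB⁆ = 0 := by rw [← lie_skew, lie_eggB_eggC, neg_zero]
    obtain ⟨a, b, c, rfl⟩ := Submodule.mem_span_triple.1 hx
    obtain ⟨a', b', c', rfl⟩ := Submodule.mem_span_triple.1 hy
    refine Submodule.mem_span_triple.2
      ⟨0, (a * b' - b * a') * (2 * Real.pi), a * c' - c * a', ?_⟩
    simp only [add_lie, lie_add, smul_lie, lie_smul, lie_self, lie_eggA_eggB, lie_eggA_eggC,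
      lie_eggB_eggC, hBA, hCA, hCB]
    module

/-- `A` as an element of the Lie algebra `span {A, B, C}`. -/
def eggA' : eggAlgebra := ⟨eggA, Submodule.subset_span (by simp)⟩

/-- `B` as an element of the Lie algebra `span {A, B, C}`. -/
def eggB' : eggAlgebra := ⟨eggB, Submodule.subset_span (by simp)⟩

/-! ### The simply connected Lie group -/

/-- The Lie group `ℝ³` with the product
`x · y = (x₁ + y₁, x₂ + e^{2π x₁} y₂, x₃ + e^{x₁} y₃)`. -/
def EggGroup : Type := ℝ × ℝ × ℝ

namespace EggGroup

instance : TopologicalSpace EggGroup := inferInstanceAs (TopologicalSpace (ℝ × ℝ × ℝ))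

instance : ChartedSpace (ℝ × ℝ × ℝ) EggGroup :=
  inferInstanceAs (ChartedSpace (ℝ × ℝ × ℝ) (ℝ × ℝ × ℝ))

instance : IsManifold 𝓘(ℝ, ℝ × ℝ × ℝ) ω EggGroup :=
  inferInstanceAs (IsManifold 𝓘(ℝ, ℝ × ℝ × ℝ) ω (ℝ × ℝ × ℝ))

def mulFun (x y : ℝ × ℝ × ℝ) : ℝ × ℝ × ℝ :=
  (x.1 + y.1, x.2.1 + Real.exp (2 * Real.pi * x.1) * y.2.1, x.2.2 + Real.exp x.1 * y.2.2)

def invFun (x : ℝ × ℝ × ℝ) : ℝ × ℝ × ℝ :=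
  (-x.1, -(Real.exp (-(2 * Real.pi * x.1)) * x.2.1), -(Real.exp (-x.1) * x.2.2))

instance : Group EggGroup :=
  { mul := mulFun
    one := ((0, 0, 0) : ℝ × ℝ × ℝ)
    inv := invFun
    mul_assoc := by
      intro x y z
      change mulFun (mulFun x y) z = mulFun x (mulFun y z)
      simp only [mulFun, mul_add, Real.exp_add]
      ext <;> simp <;> ring
    one_mul := by
      intro x
      change mulFun (0, 0, 0) x = x
      refine Prod.ext ?_ (Prod.ext ?_ ?_) <;> simp [mulFun]
    mul_one := by
      intro x
      change mulFun x (0, 0, 0) = x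
      refine Prod.ext ?_ (Prod.ext ?_ ?_) <;> simp [mulFun]
    inv_mul_cancel := by
      intro x
      change mulFun (invFun x) x = (0, 0, 0)
      simp [mulFun, invFun] }

instance : LieGroup 𝓘(ℝ, ℝ × ℝ × ℝ) ω EggGroup where
  contMDiff_mul := by
    have h : ContDiff ℝ ω fun p : (ℝ × ℝ × ℝ) × (ℝ × ℝ × ℝ) => mulFun p.1 p.2 := by
      unfold mulFun
      have h1 := Real.contDiff_exp (n := ω)
      fun_prop
    have h2 : ContMDiff (𝓘(ℝ, ℝ × ℝ × ℝ).prod 𝓘(ℝ, ℝ × ℝ × ℝ)) 𝓘(ℝ, ℝ × ℝ × ℝ) ω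
        fun p : (ℝ × ℝ × ℝ) × (ℝ × ℝ × ℝ) => mulFun p.1 p.2 := by
      rw [← modelWithCornersSelf_prod, chartedSpaceSelf_prod]
      exact h.contMDiff
    exact h2
  contMDiff_inv := by
    have h : ContDiff ℝ ω invFun := by
      unfold invFun
      have h1 := Real.contDiff_exp (n := ω)
      fun_prop
    exact h.contMDiff

end EggGroup

end

/-- `e` is the exponential map of the real Lie group `G`: for each `v` in the Lie algebra, `e v` is
the value at time `1` of the integral curve, starting at the identity, of the left-invariant vector
field determined by `v`. -/
def IsLieGroupExp {E H : Type*} [NormedAddCommGroup E] [NormedSpace ℝ E] [TopologicalSpace H]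
    {I : ModelWithCorners ℝ E H} {G : Type*} [TopologicalSpace G] [ChartedSpace H G] [Group G]
    (e : GroupLieAlgebra I G → G) : Prop :=
  ∀ v : GroupLieAlgebra I G, ∃ γ : ℝ → G,
    IsMIntegralCurve (I := I) γ (mulInvariantVectorField v) ∧ γ 0 = 1 ∧ γ 1 = e v

/-! ### Dynkin sums as coefficients of powers of a power series -/

section DynkinSums

/-! Put φ(z) = (eᶻ - 1)/z. The `A`-coordinate α kills all brackets, and each other coordinate β
satisfies β[u, v] = c (α u β v - β u α v), with c = 2π for `B` and c = 1 for `C`; α itself fits this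
with c = 0. So the BCH series reduces to one scalar computation. Under this rule β of a nested
bracket is a difference of two entries of a product of 3 × 3 matrices, which turns Dynkin's sum into
the truncated logarithm of a product of two matrix exponentials (`sum_bchIndex_prod_map_bchWord`,
`apply_rightNestedBracket`). With x = c α(X), y = c α(Y), b = β(X), b' = β(Y), the degree `n + 1`
term has as β-coordinate the coefficient of tⁿ in (eˣᵗ φ(yt) b' + φ(xt) b) / φ((x + y)t)
(`apply_bchTerm`).

On the real line φ is analytic and positive. Hence the quotient at t = 1 is analytic in all
variables, and by Abel's theorem it equals the sum wherever the series converges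
(`eq_bchSum_of_tendsto`); dividing by φ likewise inverts the exponential map of the group. But φ has
complex zeros 2πik. At (A, B) the quotient is e^{2πt}/φ(2πt), with poles on the unit circle: its
even coefficients are ±2ζ(2k), so the terms do not tend to 0 (`not_tendsto_coeff_bchSeries_zero`).
-/

theorem mem_bchIndex {n k : ℕ} {p : Fin k → ℕ × ℕ} :
    p ∈ bchIndex n k ↔ (∀ r, p r ≠ (0, 0)) ∧ ∑ r, ((p r).1 + (p r).2) = n := by
  simp only [bchIndex, Finset.mem_filter, Fintype.mem_piFinset, Finset.mem_product,
    Finset.mem_range, and_iff_right_iff_imp]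
  rintro ⟨-, rfl⟩ r
  have := Finset.single_le_sum (f := fun r => (p r).1 + (p r).2) (fun _ _ => Nat.zero_le _)
    (Finset.mem_univ r)
  omega

variable {R : Type*} [Ring R] [Algebra ℝ R]

/-- The power series `∑ₙ (aⁿ / n!) tⁿ`. -/
noncomputable def expSeries (a : R) : PowerSeries R :=
  PowerSeries.mk fun n => (1 / n.factorial : ℝ) • a ^ n

theorem coeff_expSeries_mul_expSeries_sub_one (a b : R) (n : ℕ) :
    PowerSeries.coeff n (expSeries a * expSeries b - 1) =
      ∑ q ∈ (Finset.HasAntidiagonal.antidiagonal n).filter (· ≠ (0, 0)),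
        (1 / ((q.1.factorial : ℝ) * (q.2.factorial : ℝ))) • (a ^ q.1 * b ^ q.2) := by
  have h : ∀ q : ℕ × ℕ, PowerSeries.coeff q.1 (expSeries a) * PowerSeries.coeff q.2 (expSeries b) =
      (1 / ((q.1.factorial : ℝ) * (q.2.factorial : ℝ))) • (a ^ q.1 * b ^ q.2) := by
    intro q
    simp only [expSeries, PowerSeries.coeff_mk, smul_mul_smul_comm, one_div, mul_inv]
  rw [map_sub, PowerSeries.coeff_mul, PowerSeries.coeff_one]
  simp only [h]
  rcases Nat.eq_zero_or_pos n with rfl | hn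
  · rw [Finset.HasAntidiagonal.antidiagonal_zero, Finset.filter_singleton]
    simp
  · rw [if_neg hn.ne', sub_zero, Finset.filter_true_of_mem]
    rintro ⟨i, j⟩ hq h0
    simp only [Prod.mk.injEq] at h0
    rw [Finset.HasAntidiagonal.mem_antidiagonal] at hq
    simp only at hq
    omega

theorem prod_map_bchWord_succ {R L : Type*} [Monoid R] (m : L → R) (X Y : L) {k : ℕ}
    (p : Fin (k + 1) → ℕ × ℕ) :
    ((bchWord X Y p).map m).prod =
      m X ^ (p 0).1 * m Y ^ (p 0).2 * ((bchWord X Y (Fin.tail p)).map m).prod := by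
  simp [bchWord, List.ofFn_succ, Fin.tail, mul_assoc]

/-- Each factor of the `k`-th power selects one block `(i_r, j_r)`, and subtracting 1 excludes the
block `(0, 0)`. The induction splits off the first block. -/
theorem sum_bchIndex_prod_map_bchWord {L : Type*} (m : L → R) (X Y : L) (k n : ℕ) :
    ∑ p ∈ bchIndex n k, (1 / ∏ r, (((p r).1.factorial : ℝ) * ((p r).2.factorial : ℝ))) •
        ((bchWord X Y p).map m).prod =
      PowerSeries.coeff n ((expSeries (m X) * expSeries (m Y) - 1) ^ k) := by
  induction k generalizing n with
  | zero =>
    rw [pow_zero, PowerSeries.coeff_one]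
    split_ifs with h
    · subst h
      rw [Finset.sum_eq_single (default : Fin 0 → ℕ × ℕ)]
      · simp [bchWord]
      · intro b _ hb
        exact absurd (Subsingleton.elim _ _) hb
      · intro h
        exact absurd (mem_bchIndex.2 ⟨fun r => r.elim0, by simp⟩) h
    · refine Finset.sum_eq_zero fun p hp => ?_
      have := (mem_bchIndex.1 hp).2
      simp only [Finset.univ_eq_empty, Finset.sum_empty] at this
      exact absurd this.symm h
  | succ k ih =>
    rw [pow_succ', PowerSeries.coeff_mul]
    simp only [← ih, coeff_expSeries_mul_expSeries_sub_one, Finset.sum_mul_sum, Finset.sum_sigma']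
    refine Finset.sum_bij' (fun p _ => ⟨((p 0).1 + (p 0).2, ∑ r, ((Fin.tail p r).1 +
        (Fin.tail p r).2)), p 0, Fin.tail p⟩) (fun x _ => Fin.cons x.2.1 x.2.2) ?_ ?_ ?_ ?_ ?_
    · intro p hp
      obtain ⟨h0, hn⟩ := mem_bchIndex.1 hp
      rw [Fin.sum_univ_succ] at hn
      simp only [Finset.mem_sigma, Finset.HasAntidiagonal.mem_antidiagonal,
        Finset.mem_filter, mem_bchIndex]
      exact ⟨hn, ⟨trivial, h0 0⟩, fun r => h0 r.succ, trivial⟩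
    · rintro ⟨⟨m, l⟩, q, p⟩ hx
      simp only [Finset.mem_sigma, Finset.HasAntidiagonal.mem_antidiagonal,
        Finset.mem_filter, mem_bchIndex] at hx
      obtain ⟨rfl, ⟨rfl, hq⟩, hp, rfl⟩ := hx
      refine mem_bchIndex.2 ⟨Fin.cases hq hp, ?_⟩
      simp [Fin.sum_univ_succ]
    · intro p _
      exact Fin.cons_self_tail p
    · rintro ⟨⟨m, l⟩, q, p⟩ hx
      simp only [Finset.mem_sigma, Finset.HasAntidiagonal.mem_antidiagonal,
        Finset.mem_filter, mem_bchIndex] at hx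
      obtain ⟨rfl, ⟨rfl, hq⟩, hp, rfl⟩ := hx
      simp
    · intro p _
      rw [prod_map_bchWord_succ, Fin.prod_univ_succ]
      simp only [smul_mul_smul_comm, Fin.tail, one_div, mul_inv]

end DynkinSums

/-! ### Power series identities -/

section FormalSeries

open PowerSeries

/-- The power series of `(eᵗ - 1) / t`. -/
noncomputable def expQuotSeries : PowerSeries ℝ :=
  PowerSeries.mk fun n => 1 / ((n + 1).factorial : ℝ)

theorem X_mul_expQuotSeries : X * expQuotSeries = exp ℝ - 1 := by
  ext n
  cases n <;> simp [expQuotSeries, coeff_exp, coeff_succ_X_mul, coeff_one]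

theorem rescale_X_eq (a : ℝ) : rescale a (X : PowerSeries ℝ) = C a * X := by
  ext n
  rw [coeff_rescale, coeff_C_mul, coeff_X]
  split_ifs with h <;> simp [h]

theorem rescale_C_eq (a c : ℝ) : rescale a (C c) = C c := by
  ext n
  rw [coeff_rescale, coeff_C]
  split_ifs with h <;> simp [h]

theorem C_mul_X_mul_rescale_expQuotSeries (a : ℝ) :
    C a * X * rescale a expQuotSeries = rescale a (exp ℝ) - 1 := by
  rw [← rescale_X_eq, ← map_mul, X_mul_expQuotSeries, map_sub, map_one]

theorem constantCoeff_expQuotSeries : constantCoeff expQuotSeries = 1 := by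
  rw [← coeff_zero_eq_constantCoeff_apply]
  simp [expQuotSeries]

theorem constantCoeff_rescale_expQuotSeries (a : ℝ) :
    constantCoeff (rescale a expQuotSeries) = 1 := by
  rw [← coeff_zero_eq_constantCoeff_apply, coeff_rescale]
  simp [expQuotSeries]

theorem rescale_expQuotSeries_mul_inv (a : ℝ) :
    rescale a expQuotSeries * (rescale a expQuotSeries)⁻¹ = 1 :=
  PowerSeries.mul_inv_cancel _ (by rw [constantCoeff_rescale_expQuotSeries]; exact one_ne_zero)

/-- The numerator `eˣᵗ φ(yt) b' + φ(xt) b` of the BCH group law, where `φ(t) = (eᵗ - 1) / t`. -/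
noncomputable def bchNum (x y b b' : ℝ) : PowerSeries ℝ :=
  rescale x (exp ℝ) * rescale y expQuotSeries * C b' + rescale x expQuotSeries * C b

/-- The power series of the BCH group law. -/
noncomputable def bchSeries (x y b b' : ℝ) : PowerSeries ℝ :=
  bchNum x y b b' * (rescale (x + y) expQuotSeries)⁻¹

theorem bchSeries_mul (x y b b' : ℝ) :
    bchSeries x y b b' * rescale (x + y) expQuotSeries = bchNum x y b b' := by
  rw [bchSeries, mul_assoc, mul_comm _⁻¹, rescale_expQuotSeries_mul_inv, mul_one]

/-- The defect `(x + y) t N - t N'` for `N = bchNum x y b b'`. -/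
noncomputable def bchDefect (x y b b' : ℝ) : PowerSeries ℝ :=
  rescale x (exp ℝ) * (rescale y expQuotSeries - 1) * C b' +
    rescale x expQuotSeries * C b * (C y * X) + (rescale x expQuotSeries - 1) * C b

theorem X_mul_derivative_rescale_exp (a : ℝ) :
    X * d⁄dX ℝ (rescale a (exp ℝ)) = C a * X * rescale a (exp ℝ) := by
  ext n
  rw [mul_assoc, coeff_C_mul]
  cases n with
  | zero => simp
  | succ n =>
    rw [coeff_succ_X_mul, coeff_succ_X_mul, coeff_derivative]
    simp only [coeff_rescale, coeff_exp, Nat.factorial_succ]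
    push_cast
    have : (n.factorial : ℝ) ≠ 0 := by positivity
    simp
    field_simp
    ring

theorem X_mul_derivative_rescale_expQuotSeries (a : ℝ) :
    X * d⁄dX ℝ (rescale a expQuotSeries) = rescale a (exp ℝ) - rescale a expQuotSeries := by
  ext n
  rw [map_sub]
  cases n with
  | zero =>
    rw [coeff_zero_X_mul, coeff_rescale, coeff_rescale, coeff_exp, expQuotSeries, coeff_mk]
    simp
  | succ n =>
    rw [coeff_succ_X_mul, coeff_derivative]
    simp only [coeff_rescale, coeff_exp, expQuotSeries, coeff_mk, Nat.factorial_succ]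
    push_cast
    have : (n.factorial : ℝ) ≠ 0 := by positivity
    simp
    field_simp
    ring

theorem X_mul_derivative_bchNum (x y b b' : ℝ) :
    X * d⁄dX ℝ (bchNum x y b b') = C (x + y) * X * bchNum x y b b' - bchDefect x y b b' := by
  have h1 := X_mul_derivative_rescale_exp x
  have h2 := X_mul_derivative_rescale_expQuotSeries x
  have h3 := X_mul_derivative_rescale_expQuotSeries y
  have h4 := C_mul_X_mul_rescale_expQuotSeries x
  have h5 := C_mul_X_mul_rescale_expQuotSeries y
  rw [bchNum, bchDefect]
  simp only [map_add, Derivation.leibniz, smul_eq_mul, derivative_C, mul_zero, zero_add]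
  linear_combination (rescale y expQuotSeries * C b') * h1 + C b * h2 +
    (rescale x (exp ℝ) * C b') * h3 - C b * h4 - (rescale x (exp ℝ) * C b') * h5

/-- This recognises the combination produced by the matrix logarithm as a derivative, so that
Dynkin's factor 1/n can be cancelled. -/
theorem X_mul_derivative_bchSeries (x y b b' : ℝ) :
    X * d⁄dX ℝ (bchSeries x y b b') =
      -(bchDefect x y b b' * (rescale (x + y) expQuotSeries)⁻¹ + bchSeries x y b b' *
        ((rescale (x + y) expQuotSeries)⁻¹ - 1)) := by
  have h1 := X_mul_derivative_bchNum x y b b'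
  have h2 := X_mul_derivative_rescale_expQuotSeries (x + y)
  have h3 := C_mul_X_mul_rescale_expQuotSeries (x + y)
  have h4 := rescale_expQuotSeries_mul_inv (x + y)
  rw [bchSeries]
  simp only [Derivation.leibniz, smul_eq_mul, derivative_inv']
  set P := rescale (x + y) expQuotSeries
  set Q := P⁻¹
  set N := bchNum x y b b'
  linear_combination Q * h1 - N * Q ^ 2 * h2 + N * Q ^ 2 * h3 +
    (-N * Q * C (x + y) * X + N * Q) * h4

/-! ### The truncated logarithm -/

/-- With z = eᵗ - 1, so that z' = 1 + z, the derivative of the truncated logarithm is a geometric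
sum times 1 + z. It telescopes to 1 - (-z)ⁿ, and z is divisible by t. -/
theorem X_pow_dvd_sum_log_exp (n : ℕ) :
    X ^ (n + 1) ∣ ∑ k ∈ Finset.Icc 1 n, C ((-1) ^ (k + 1) / k : ℝ) * (exp ℝ - 1) ^ k - X := by
  rw [X_pow_dvd_iff]
  intro m hm
  have hd : d⁄dX ℝ (∑ k ∈ Finset.Icc 1 n, C ((-1) ^ (k + 1) / k : ℝ) * (exp ℝ - 1) ^ k - X) =
      -(-(exp ℝ - 1)) ^ n := by
    clear hm
    induction n with
    | zero => simp
    | succ n ih =>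
      rw [Finset.sum_Icc_succ_top (by omega), add_sub_right_comm, map_add, ih]
      simp only [Derivation.leibniz, derivative_C, derivative_pow, derivative_exp, map_sub,
        derivative_one, smul_eq_mul, mul_zero, add_zero, Nat.add_sub_cancel, sub_zero]
      have : (C ((-1) ^ (n + 1 + 1) / ((n + 1 : ℕ) : ℝ)) : PowerSeries ℝ) *
          ((n + 1 : ℕ) : PowerSeries ℝ) = (-1) ^ n := by
        have h : ((n + 1 : ℕ) : PowerSeries ℝ) = C ((n + 1 : ℕ) : ℝ) := by simp
        rw [h, ← map_mul, div_mul_cancel₀ _ (by positivity)]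
        simp [pow_succ]
      rw [neg_pow (exp ℝ - 1), neg_pow (exp ℝ - 1) (n+1)]
      linear_combination ((exp ℝ - 1) ^ n * exp ℝ) * this
  cases m with
  | zero =>
    rw [coeff_zero_eq_constantCoeff_apply]
    simp only [map_sub, map_sum, map_mul, map_pow, constantCoeff_exp, map_one, sub_self,
      constantCoeff_X, sub_zero]
    refine Finset.sum_eq_zero fun k hk => ?_
    rw [zero_pow (by have := (Finset.mem_Icc.1 hk).1; omega), mul_zero]
  | succ m =>
    have h1 : coeff m (-(-(exp ℝ - 1)) ^ n) = 0 := by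
      have : X ^ n ∣ -(-(exp ℝ - 1)) ^ n := by
        rw [dvd_neg]
        refine pow_dvd_pow_of_dvd ?_ n
        rw [dvd_neg, ← X_mul_expQuotSeries]
        exact dvd_mul_right _ _
      exact X_pow_dvd_iff.1 this m (by omega)
    rw [← hd, coeff_derivative] at h1
    exact (mul_eq_zero.1 h1).resolve_right (by positivity)

/-- The preceding congruence divided by eᵗ - 1. Since `X` is cancelled before rescaling, `s = 0` is
not exceptional. -/
theorem X_pow_dvd_sum_sub_inv (s : ℝ) {n : ℕ} :
    X ^ n ∣ ∑ k ∈ Finset.Icc 1 n, C ((-1) ^ (k + 1) / k : ℝ) * (rescale s (exp ℝ) - 1) ^ (k - 1) -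
      (rescale s expQuotSeries)⁻¹ := by
  have h1 : X ^ n ∣ ∑ k ∈ Finset.Icc 1 n, C ((-1) ^ (k + 1) / k : ℝ) * (exp ℝ - 1) ^ (k - 1) *
      expQuotSeries - 1 := by
    obtain ⟨q, hq⟩ := X_pow_dvd_sum_log_exp n
    refine ⟨q, mul_left_cancel₀ (X_ne_zero (R := ℝ)) ?_⟩
    rw [← mul_assoc, ← pow_succ', ← hq, mul_sub, mul_one, Finset.mul_sum]
    congr 1
    refine Finset.sum_congr rfl fun k hk => ?_
    obtain ⟨j, rfl⟩ := Nat.exists_eq_add_of_le' (Finset.mem_Icc.1 hk).1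
    rw [Nat.add_sub_cancel, pow_succ, ← X_mul_expQuotSeries]
    ring
  obtain ⟨q, hq⟩ := h1
  have h2 := congrArg (rescale s) hq
  simp only [map_sub, map_sum, map_mul, map_pow, map_one, rescale_X_eq, rescale_C_eq] at h2
  rw [← Finset.sum_mul] at h2
  have h4 := rescale_expQuotSeries_mul_inv s
  refine ⟨C s ^ n * rescale s q * (rescale s expQuotSeries)⁻¹, ?_⟩
  rw [mul_pow] at h2
  linear_combination (rescale s expQuotSeries)⁻¹ * h2 -
    (∑ k ∈ Finset.Icc 1 n, C ((-1) ^ (k + 1) / k : ℝ) * (rescale s (exp ℝ) - 1) ^ (k - 1)) * h4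

end FormalSeries

/-! ### Coordinates of the BCH series -/

section Coordinates

open PowerSeries

/-- The matrix of power series whose entries are those of a series of matrices. -/
noncomputable def entrySeries (P : PowerSeries (Matrix (Fin 3) (Fin 3) ℝ)) :
    Matrix (Fin 3) (Fin 3) (PowerSeries ℝ) :=
  Matrix.of fun i j => PowerSeries.mk fun n => coeff n P i j

theorem coeff_entrySeries (P : PowerSeries (Matrix (Fin 3) (Fin 3) ℝ)) (i j : Fin 3) (n : ℕ) :
    coeff n (entrySeries P i j) = coeff n P i j := by
  simp [entrySeries]

theorem entrySeries_mul (P Q : PowerSeries (Matrix (Fin 3) (Fin 3) ℝ)) :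
    entrySeries (P * Q) = entrySeries P * entrySeries Q := by
  ext i j n
  simp only [Matrix.mul_apply, map_sum, coeff_mul, coeff_entrySeries, Matrix.sum_apply]
  exact Finset.sum_comm

theorem entrySeries_one : entrySeries 1 = 1 := by
  ext i j n
  rw [coeff_entrySeries, coeff_one]
  rcases eq_or_ne i j with rfl | hij
  · rw [Matrix.one_apply_eq, coeff_one]
    split_ifs
    · exact Matrix.one_apply_eq i
    · rfl
  · rw [Matrix.one_apply_ne hij, map_zero]
    split_ifs
    · exact Matrix.one_apply_ne hij
    · rfl

theorem entrySeries_sub (P Q : PowerSeries (Matrix (Fin 3) (Fin 3) ℝ)) :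
    entrySeries (P - Q) = entrySeries P - entrySeries Q := by
  ext i j n
  simp [coeff_entrySeries]

theorem entrySeries_pow (P : PowerSeries (Matrix (Fin 3) (Fin 3) ℝ)) (k : ℕ) :
    entrySeries (P ^ k) = entrySeries P ^ k := by
  induction k with
  | zero => simp [entrySeries_one]
  | succ k ih => rw [pow_succ, pow_succ, entrySeries_mul, ih]

/-! ### Nested brackets as matrix products -/

/-- The matrix whose products compute right-nested brackets. -/
def bracketMatrix (a b : ℝ) : Matrix (Fin 3) (Fin 3) ℝ :=
  !![a, b, 0; 0, 0, a; 0, 0, 0]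

theorem bracketMatrix_pow (a b : ℝ) (n : ℕ) :
    bracketMatrix a b ^ (n + 2) = !![a ^ (n + 2), a ^ (n + 1) * b, a ^ (n + 1) * b;
      0, 0, 0; 0, 0, 0] := by
  induction n with
  | zero =>
    ext i j
    fin_cases i <;> fin_cases j <;>
      simp [bracketMatrix, pow_two, Matrix.mul_apply, Fin.sum_univ_three, mul_comm]
  | succ n ih =>
    rw [pow_succ', ih]
    ext i j
    fin_cases i <;> fin_cases j <;> simp [bracketMatrix, Matrix.mul_apply, Fin.sum_univ_three] <;> ring

theorem entrySeries_expSeries_bracketMatrix (a b : ℝ) :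
    entrySeries (expSeries (bracketMatrix a b)) =
      !![rescale a (exp ℝ), X * rescale a expQuotSeries * C b,
          X * (rescale a expQuotSeries - 1) * C b;
        0, 1, C a * X; 0, 0, 1] := by
  ext i j n
  rw [coeff_entrySeries, expSeries, coeff_mk]
  match n with
  | 0 =>
    fin_cases i <;> fin_cases j <;>
      simp [-coeff_zero_eq_constantCoeff, coeff_rescale, coeff_exp, mul_assoc, coeff_one, coeff_zero_X_mul]
  | 1 =>
    fin_cases i <;> fin_cases j <;>
      simp [bracketMatrix, coeff_rescale, coeff_exp, mul_assoc, coeff_one, constantCoeff_expQuotSeries,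
        constantCoeff_rescale_expQuotSeries]
  | n + 2 =>
    rw [bracketMatrix_pow]
    fin_cases i <;> fin_cases j <;>
      simp [coeff_rescale, coeff_exp, mul_assoc, coeff_one, coeff_succ_X_mul,
        coeff_mul_C, expQuotSeries] <;> ring

theorem entrySeries_bch (x y b b' : ℝ) :
    entrySeries (expSeries (bracketMatrix x b) * expSeries (bracketMatrix y b') - 1) =
      !![rescale (x + y) (exp ℝ) - 1, X * bchNum x y b b', X * bchDefect x y b b';
        0, 0, C (x + y) * X; 0, 0, 0] := by
  rw [entrySeries_sub, entrySeries_mul, entrySeries_one, entrySeries_expSeries_bracketMatrix,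
    entrySeries_expSeries_bracketMatrix, ← exp_mul_exp_eq_exp_add]
  refine Matrix.ext fun i j => ?_
  fin_cases i <;> fin_cases j <;>
    simp [bchNum, bchDefect] <;> ring

/-- A path from 0 to 2 ends either with `q`, or with `p` followed by `r`. The conditionals remove
the second kind from the first power, where truncated subtraction would give `e ^ 0`. -/
theorem triangular_pow {S : Type*} [CommRing S] (e p q r : S) (k : ℕ) :
    (!![e, p, q; 0, 0, r; 0, 0, 0] : Matrix (Fin 3) (Fin 3) S) ^ (k + 1) =
      !![e ^ (k + 1), e ^ k * p, e ^ k * q + (if k = 0 then 0 else e ^ (k - 1)) * p * r;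
        0, 0, if k = 0 then r else 0; 0, 0, 0] := by
  induction k with
  | zero => simp
  | succ k ih =>
    rw [pow_succ', ih]
    refine Matrix.ext fun i j => ?_
    rcases Nat.eq_zero_or_pos k with rfl | hk
    · fin_cases i <;> fin_cases j <;> simp [Matrix.mul_apply, Fin.sum_univ_three] <;> ring
    · obtain ⟨k, rfl⟩ := Nat.exists_eq_add_of_le' hk
      fin_cases i <;> fin_cases j <;> simp [Matrix.mul_apply, Fin.sum_univ_three] <;> ring

variable {L : Type*} [LieRing L] [LieAlgebra ℝ L]

/-- If `α` and `β` are linear forms with `α [u, v] = 0` and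
`β [u, v] = c (α u β v - β u α v)`, then `β` of a right-nested bracket is a difference of entries
of a product of matrices. -/
theorem apply_rightNestedBracket {α β : L →ₗ[ℝ] ℝ} {c : ℝ} (hα : ∀ u v : L, α ⁅u, v⁆ = 0)
    (hβ : ∀ u v : L, β ⁅u, v⁆ = c * (α u * β v - β u * α v)) (w : List L) :
    β (rightNestedBracket w) =
      (w.map fun u => bracketMatrix (c * α u) (β u)).prod 0 1 -
        (w.map fun u => bracketMatrix (c * α u) (β u)).prod 0 2 := by
  -- For words of length at least two, row 1 of the product vanishes and α kills the bracket, so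
  -- prepending a letter only multiplies both sides by `c * α u`.
  have key : ∀ (w : List L) (u v : L),
      β (rightNestedBracket (u :: v :: w)) =
        ((u :: v :: w).map fun u => bracketMatrix (c * α u) (β u)).prod 0 1 -
          ((u :: v :: w).map fun u => bracketMatrix (c * α u) (β u)).prod 0 2 ∧
      ∀ j, ((u :: v :: w).map fun u => bracketMatrix (c * α u) (β u)).prod 1 j = 0 := by
    have h2 : ∀ (P : Matrix (Fin 3) (Fin 3) ℝ) (a b : ℝ) (j : Fin 3),
        (bracketMatrix a b * P) 2 j = 0 := by
      intro P a b j
      simp [bracketMatrix, Matrix.mul_apply, Fin.sum_univ_three]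
    have h1 : ∀ (P : Matrix (Fin 3) (Fin 3) ℝ) (a b : ℝ) (j : Fin 3),
        (bracketMatrix a b * P) 1 j = a * P 2 j := by
      intro P a b j
      simp [bracketMatrix, Matrix.mul_apply, Fin.sum_univ_three]
    have h0 : ∀ (P : Matrix (Fin 3) (Fin 3) ℝ) (a b : ℝ) (j : Fin 3),
        (bracketMatrix a b * P) 0 j = a * P 0 j + b * P 1 j := by
      intro P a b j
      simp [bracketMatrix, Matrix.mul_apply, Fin.sum_univ_three]
    intro w
    induction w with
    | nil =>
      intro u v
      simp only [rightNestedBracket, List.map_cons, List.map_nil, List.prod_cons, List.prod_nil,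
        h0, h1, h2, hβ]
      simp
      ring
    | cons z w ih =>
      intro u v
      obtain ⟨ih1, ih2⟩ := ih v z
      have hr : α (rightNestedBracket (v :: z :: w)) = 0 := hα _ _
      refine ⟨?_, fun j => ?_⟩
      · rw [List.map_cons, List.prod_cons, h0, h0, ih2, ih2, rightNestedBracket, hβ, hr, ih1]
        ring
      · rw [List.map_cons, List.prod_cons, h1, List.map_cons, List.prod_cons, h2, mul_zero]
  match w with
  | [] => simp [rightNestedBracket]
  | [u] => simp [rightNestedBracket, bracketMatrix]
  | u :: v :: w => exact (key w u v).1

/-- With B the `bchSeries`, the entries of the truncated logarithm give t (B + t B') modulo tⁿ⁺².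
The coefficient of tⁿ⁺¹ is n + 1 times that of tⁿ in B, which cancels Dynkin's 1/(n + 1). -/
theorem apply_bchTerm {α β : L →ₗ[ℝ] ℝ} {c : ℝ} (hα : ∀ u v : L, α ⁅u, v⁆ = 0)
    (hβ : ∀ u v : L, β ⁅u, v⁆ = c * (α u * β v - β u * α v)) (u v : L) (n : ℕ) :
    β (bchTerm (n + 1) u v) = coeff n (bchSeries (c * α u) (c * α v) (β u) (β v)) := by
  set x := c * α u with hx
  set y := c * α v with hy
  set b := β u with hb
  set b' := β v with hb'
  set W := expSeries (bracketMatrix x b) * expSeries (bracketMatrix y b') - 1 with hW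
  have h1 : β (bchTerm (n + 1) u v) = (1 / (n + 1 : ℕ) : ℝ) * coeff (n + 1)
      (∑ k ∈ Finset.Icc 1 (n + 1), C ((-1) ^ (k + 1) / k : ℝ) *
        (entrySeries (W ^ k) 0 1 - entrySeries (W ^ k) 0 2)) := by
    simp only [bchTerm, map_smul, map_sum, smul_eq_mul, coeff_C_mul]
    congr 1
    refine Finset.sum_congr rfl fun k _ => ?_
    congr 1
    rw [map_sub, coeff_entrySeries, coeff_entrySeries, hW, hx, hb, hy, hb',
      ← sum_bchIndex_prod_map_bchWord (fun z => bracketMatrix (c * α z) (β z)),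
      Matrix.sum_apply, Matrix.sum_apply, ← Finset.sum_sub_distrib]
    refine Finset.sum_congr rfl fun p _ => ?_
    rw [apply_rightNestedBracket hα hβ, Matrix.smul_apply, Matrix.smul_apply, smul_eq_mul,
      smul_eq_mul, mul_sub]
  set N := bchNum x y b b' with hN
  set M := bchDefect x y b b' with hM
  set E := rescale (x + y) (exp ℝ) - 1 with hE
  set P := rescale (x + y) expQuotSeries with hP
  set S := ∑ k ∈ Finset.Icc 1 (n + 1), C ((-1) ^ (k + 1) / k : ℝ) * E ^ (k - 1) with hS
  -- `T` collects the paths through entry (1, 2), which use two off-diagonal steps and are absent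
  -- for `k = 1`.
  set T := ∑ k ∈ Finset.Icc 1 (n + 1),
    C ((-1) ^ (k + 1) / k : ℝ) * (if k = 1 then 0 else E ^ (k - 2)) with hT
  have h2 : ∑ k ∈ Finset.Icc 1 (n + 1), C ((-1) ^ (k + 1) / k : ℝ) *
        (entrySeries (W ^ k) 0 1 - entrySeries (W ^ k) 0 2) =
      X * (N * S - M * S - N * (C (x + y) * X * T)) := by
    simp only [hS, hT, Finset.mul_sum, ← Finset.sum_sub_distrib]
    refine Finset.sum_congr rfl fun k hk => ?_
    obtain ⟨j, rfl⟩ := Nat.exists_eq_add_of_le' (Finset.mem_Icc.1 hk).1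
    rw [entrySeries_pow, hW, entrySeries_bch, triangular_pow]
    simp only [Matrix.of_apply, Matrix.cons_val', Matrix.cons_val_zero, Matrix.cons_val_one,
      Matrix.cons_val, Nat.add_sub_cancel, Nat.add_eq_right, show j + 1 - 2 = j - 1 by omega]
    ring
  have hEP : C (x + y) * X * P = E := C_mul_X_mul_rescale_expQuotSeries _
  have hPQ : P * P⁻¹ = 1 := rescale_expQuotSeries_mul_inv _
  have hST : S = 1 + E * T := by
    rw [hS, hT, ← Finset.add_sum_Ioc_eq_sum_Icc (by omega), ← Finset.add_sum_Ioc_eq_sum_Icc (by omega)]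
    simp only [if_true, mul_zero, zero_add, Finset.mul_sum]
    congr 1
    · simp
    · refine Finset.sum_congr rfl fun k hk => ?_
      have hk1 := (Finset.mem_Ioc.1 hk).1
      obtain ⟨j, rfl⟩ := Nat.exists_eq_add_of_le' hk1
      rw [if_neg (by omega), show j + Nat.succ 1 - 1 = j + 1 by omega,
        show j + Nat.succ 1 - 2 = j by omega, pow_succ]
      ring
  -- Replacing `E` by `C (x + y) * X * P` and inverting only `P` avoids a division by `x + y`, which
  -- may be zero.
  have hT' : C (x + y) * X * T = P⁻¹ * (S - 1) := by
    linear_combination (-P⁻¹) * hST - (C (x + y) * X * T) * hPQ + P⁻¹ * T * hEP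
  obtain ⟨q, hq⟩ := X_pow_dvd_sum_sub_inv (x + y) (n := n + 1)
  have hq' : S = P⁻¹ + X ^ (n + 1) * q := by rw [← hq]; ring
  have h3 : X * (N * S - M * S - N * (C (x + y) * X * T)) =
      X * (bchSeries x y b b' + X * d⁄dX ℝ (bchSeries x y b b') + X ^ (n + 1) *
        (q * (N - M - N * P⁻¹))) := by
    rw [X_mul_derivative_bchSeries, hT', hq', bchSeries]
    ring
  rw [h1, h2, h3, coeff_succ_X_mul, map_add, map_add, coeff_X_pow_mul', if_neg (by omega), add_zero]
  have h4 : ∀ f : PowerSeries ℝ, coeff n (X * d⁄dX ℝ f) = n * coeff n f := by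
    intro f
    cases n with
    | zero => simp
    | succ n => rw [coeff_succ_X_mul, coeff_derivative, mul_comm]; push_cast; rfl
  rw [h4]
  push_cast
  field_simp
  ring

end Coordinates

/-! ### Convergence of the coordinates -/

section Convergence

open PowerSeries

/-- The function `(eᶻ - 1) / z`, with value `1` at `0`. -/
noncomputable def expQuot (z : ℝ) : ℝ :=
  if z = 0 then 1 else (Real.exp z - 1) / z

theorem expQuot_zero : expQuot 0 = 1 := if_pos rfl

theorem mul_expQuot (z : ℝ) : z * expQuot z = Real.exp z - 1 := by
  rcases eq_or_ne z 0 with rfl | hz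
  · simp
  · rw [expQuot, if_neg hz, mul_div_cancel₀ _ hz]

theorem expQuot_pos (z : ℝ) : 0 < expQuot z := by
  rw [expQuot]
  split_ifs with h
  · exact one_pos
  · rcases lt_or_gt_of_ne h with h | h
    · exact div_pos_of_neg_of_neg (by linarith [Real.exp_lt_one_iff.2 h]) h
    · exact div_pos (by linarith [Real.one_lt_exp_iff.2 h]) h

/-- The divided slope supplies the power series at the removable singularity 0. -/
theorem expQuot_eq_dslope : expQuot = dslope Real.exp 0 := by
  ext z
  rcases eq_or_ne z 0 with rfl | hz
  · rw [dslope_same, expQuot_zero, Real.deriv_exp, Real.exp_zero]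
  · rw [dslope_of_ne _ hz, slope_def_field, expQuot, if_neg hz, Real.exp_zero, sub_zero]

theorem analyticAt_expQuot (z : ℝ) : AnalyticAt ℝ expQuot z := by
  rcases eq_or_ne z 0 with rfl | hz
  · obtain ⟨p, hp⟩ := analyticAt_rexp (x := 0)
    rw [expQuot_eq_dslope]
    exact ⟨_, hp.has_fpower_series_dslope_fslope⟩
  · have h : AnalyticAt ℝ (fun w => (Real.exp w - 1) / w) z :=
      (analyticAt_rexp.sub analyticAt_const).div analyticAt_id hz
    refine h.congr ?_
    filter_upwards [isOpen_ne.mem_nhds hz] with w hw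
    exact (if_neg hw).symm

/-- The power series `f` converges absolutely at `t`, with sum `v`. -/
def AbsHasSumAt (f : PowerSeries ℝ) (t v : ℝ) : Prop :=
  Summable (fun n => ‖coeff n f * t ^ n‖) ∧ HasSum (fun n => coeff n f * t ^ n) v

theorem AbsHasSumAt.add {f g : PowerSeries ℝ} {t v w : ℝ} (hf : AbsHasSumAt f t v)
    (hg : AbsHasSumAt g t w) : AbsHasSumAt (f + g) t (v + w) := by
  have h : ∀ n, coeff n (f + g) * t ^ n = coeff n f * t ^ n + coeff n g * t ^ n := by
    intro n
    rw [map_add, add_mul]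
  refine ⟨?_, ?_⟩
  · simp only [h]
    exact (hf.1.add hg.1).of_nonneg_of_le (fun _ => norm_nonneg _) fun n => norm_add_le _ _
  · simp only [h]
    exact hf.2.add hg.2

theorem coeff_mul_mul_pow (f g : PowerSeries ℝ) (t : ℝ) (n : ℕ) :
    coeff n (f * g) * t ^ n = ∑ q ∈ Finset.HasAntidiagonal.antidiagonal n,
      (coeff q.1 f * t ^ q.1) * (coeff q.2 g * t ^ q.2) := by
  rw [coeff_mul, Finset.sum_mul]
  refine Finset.sum_congr rfl fun q hq => ?_
  rw [← Finset.HasAntidiagonal.mem_antidiagonal.1 hq, pow_add]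
  ring

theorem AbsHasSumAt.mul {f g : PowerSeries ℝ} {t v w : ℝ} (hf : AbsHasSumAt f t v)
    (hg : AbsHasSumAt g t w) : AbsHasSumAt (f * g) t (v * w) := by
  have h := summable_norm_sum_mul_antidiagonal_of_summable_norm hf.1 hg.1
  refine ⟨?_, ?_⟩
  · simpa only [coeff_mul_mul_pow] using h
  · simp only [coeff_mul_mul_pow]
    rw [← hf.2.tsum_eq, ← hg.2.tsum_eq,
      tsum_mul_tsum_eq_tsum_sum_antidiagonal_of_summable_norm hf.1 hg.1]
    exact h.of_norm.hasSum

theorem absHasSumAt_C (c t : ℝ) : AbsHasSumAt (C c) t c := by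
  have h : ∀ n ≠ 0, coeff n (C c) * t ^ n = 0 := by
    intro n hn
    rw [coeff_C, if_neg hn, zero_mul]
  refine ⟨summable_of_ne_finset_zero (s := {0}) fun n hn => ?_, ?_⟩
  · rw [h n (by simpa using hn), norm_zero]
  · convert! hasSum_single 0 h using 1
    simp

theorem absHasSumAt_rescale_exp (a t : ℝ) :
    AbsHasSumAt (rescale a (exp ℝ)) t (Real.exp (a * t)) := by
  have h : ∀ n, coeff n (rescale a (exp ℝ)) * t ^ n = (a * t) ^ n / n.factorial := by
    intro n
    rw [coeff_rescale, coeff_exp, mul_pow]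
    simp
    ring
  refine ⟨?_, ?_⟩
  · simp only [h]
    exact NormedSpace.norm_expSeries_div_summable (a * t)
  · simp only [h, Real.exp_eq_exp_ℝ]
    exact NormedSpace.expSeries_div_hasSum_exp (a * t)

theorem absHasSumAt_rescale_expQuotSeries (a t : ℝ) :
    AbsHasSumAt (rescale a expQuotSeries) t (expQuot (a * t)) := by
  have h : ∀ n, coeff n (rescale a expQuotSeries) * t ^ n = (a * t) ^ n / (n + 1).factorial := by
    intro n
    rw [coeff_rescale, expQuotSeries, coeff_mk, mul_pow]
    ring
  refine ⟨?_, ?_⟩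
  · simp only [h]
    refine (NormedSpace.norm_expSeries_div_summable (a * t)).of_nonneg_of_le
      (fun _ => norm_nonneg _) fun n => ?_
    rw [norm_div, norm_div]
    simp only [RCLike.norm_natCast]
    have := Nat.factorial_le (Nat.le_succ n)
    gcongr
  · simp only [h]
    generalize a * t = z
    rcases eq_or_ne z 0 with rfl | hz
    · convert! hasSum_single 0 (f := fun n : ℕ => (0 : ℝ) ^ n / (n + 1).factorial) ?_ using 1
      · simp [expQuot_zero]
      · intro n hn
        simp [hn]
    · have h1 := NormedSpace.expSeries_div_hasSum_exp z
      rw [← Real.exp_eq_exp_ℝ, ← hasSum_nat_add_iff' 1] at h1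
      have h2 := h1.div_const z
      rw [expQuot, if_neg hz]
      convert! h2 using 1
      · ext n
        rw [pow_succ]
        field_simp
      · simp

theorem absHasSumAt_bchNum (x y b b' t : ℝ) :
    AbsHasSumAt (bchNum x y b b') t
      (Real.exp (x * t) * expQuot (y * t) * b' + expQuot (x * t) * b) :=
  (((absHasSumAt_rescale_exp x t).mul (absHasSumAt_rescale_expQuotSeries y t)).mul
    (absHasSumAt_C b' t)).add ((absHasSumAt_rescale_expQuotSeries x t).mul (absHasSumAt_C b t))

/-! ### Convergence near the origin -/

theorem expQuotSeries_mul_inv : expQuotSeries * expQuotSeries⁻¹ = 1 :=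
  PowerSeries.mul_inv_cancel _ (by rw [constantCoeff_expQuotSeries]; exact one_ne_zero)

theorem sum_range_one_div_factorial_add_two_le (n : ℕ) :
    ∑ i ∈ Finset.range n, 1 / ((i + 2).factorial : ℝ) ≤ 1 - 1 / ((n + 1).factorial : ℝ) := by
  induction n with
  | zero => simp
  | succ n ih =>
    rw [Finset.sum_range_succ]
    have h : 2 * (1 / ((n + 2).factorial : ℝ)) ≤ 1 / ((n + 1).factorial : ℝ) := by
      rw [Nat.factorial_succ (n + 1)]
      push_cast
      have h0 : (0 : ℝ) < (n + 1).factorial := by positivity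
      rw [mul_one_div, div_le_div_iff₀ (by positivity) h0]
      nlinarith [(Nat.cast_nonneg n : (0 : ℝ) ≤ n)]
    have h' : n + 1 + 1 = n + 2 := rfl
    rw [h']
    linarith

/-- Each coefficient of 1/φ is minus a combination of earlier ones with weights 1/(i + 2)!, whose
sum is at most 1. -/
theorem abs_coeff_expQuotSeries_inv_le (n : ℕ) : |coeff n expQuotSeries⁻¹| ≤ 1 := by
  induction n using Nat.strong_induction_on with
  | _ n ih =>
    cases n with
    | zero => simp [constantCoeff_expQuotSeries]
    | succ n =>
      have h := congrArg (coeff (n + 1)) expQuotSeries_mul_inv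
      rw [coeff_mul, coeff_one, if_neg (by omega), Finset.Nat.antidiagonal_succ,
        Finset.sum_cons, coeff_zero_eq_constantCoeff_apply, constantCoeff_expQuotSeries, one_mul,
        Finset.sum_map] at h
      rw [eq_neg_of_add_eq_zero_left h, abs_neg]
      refine (Finset.abs_sum_le_sum_abs _ _).trans ?_
      have h2 : ∑ q ∈ Finset.HasAntidiagonal.antidiagonal n, 1 / ((q.1 + 2).factorial : ℝ) ≤ 1 := by
        rw [Finset.Nat.sum_antidiagonal_eq_sum_range_succ_mk]
        refine (sum_range_one_div_factorial_add_two_le (n + 1)).trans ?_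
        have : (0 : ℝ) ≤ 1 / ((n + 1 + 1).factorial : ℝ) := by positivity
        linarith
      refine le_trans (Finset.sum_le_sum fun q hq => ?_) h2
      have hq' := Finset.HasAntidiagonal.mem_antidiagonal.1 hq
      have h3 := ih q.2 (by omega)
      have h4 : (0 : ℝ) ≤ 1 / ((q.1 + 2).factorial : ℝ) := by positivity
      simp only [Function.Embedding.prodMap, Function.Embedding.coeFn_mk, Prod.map,
        Function.Embedding.refl_apply, expQuotSeries, coeff_mk, abs_mul] at h3 ⊢
      rw [abs_of_nonneg (by positivity)]
      exact mul_le_of_le_one_right h4 h3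

theorem rescale_expQuotSeries_inv (s : ℝ) :
    (rescale s expQuotSeries)⁻¹ = rescale s expQuotSeries⁻¹ := by
  have h := rescale_expQuotSeries_mul_inv s
  have h2 := congrArg (rescale s) expQuotSeries_mul_inv
  rw [map_mul, map_one] at h2
  linear_combination (-(rescale s expQuotSeries)⁻¹) * h2 + rescale s expQuotSeries⁻¹ * h

theorem summable_coeff_bchSeries {x y : ℝ} (h : |x + y| < 1) (b b' : ℝ) :
    Summable fun n => coeff n (bchSeries x y b b') := by
  have h1 : Summable fun n => ‖coeff n (rescale (x + y) expQuotSeries)⁻¹ * (1 : ℝ) ^ n‖ := by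
    refine (summable_geometric_of_lt_one (abs_nonneg _) h).of_nonneg_of_le
      (fun _ => norm_nonneg _) fun n => ?_
    rw [one_pow, mul_one, rescale_expQuotSeries_inv, coeff_rescale, norm_mul, norm_pow]
    exact mul_le_of_le_one_right (by positivity) (abs_coeff_expQuotSeries_inv_le n)
  have h2 := ((absHasSumAt_bchNum x y b b' 1).mul ⟨h1, h1.of_norm.hasSum⟩).2.summable
  simpa only [one_pow, mul_one, bchSeries] using h2

/-- The sum of the series `bchSeries x y b b'`, continued analytically. -/
noncomputable def bchSum (x y b b' : ℝ) : ℝ :=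
  (Real.exp x * expQuot y * b' + expQuot x * b) / expQuot (x + y)

/-- Abel's theorem reduces the claim to 0 < t < 1, where a Cauchy product identifies the sum with
the quotient; that quotient is continuous at t = 1 because φ is positive. -/
theorem eq_bchSum_of_tendsto {x y b b' l : ℝ}
    (h : Tendsto (fun N => ∑ n ∈ Finset.range N, coeff n (bchSeries x y b b')) atTop (𝓝 l)) :
    l = bchSum x y b b' := by
  have habel := Real.tendsto_tsum_powerSeries_nhdsWithin_lt h
  -- Convergence is only conditional at t = 1; bounded coefficients give the absolute convergence
  -- for t < 1 that Cauchy products need.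
  have hbdd : ∃ M, ∀ n, ‖coeff n (bchSeries x y b b')‖ ≤ M := by
    have h0 : Tendsto (fun n => coeff n (bchSeries x y b b')) atTop (𝓝 0) := by
      have := (h.comp (tendsto_add_atTop_nat 1)).sub h
      simpa [Finset.sum_range_succ] using this
    obtain ⟨M, hM⟩ := h0.norm.bddAbove_range
    exact ⟨M, fun n => hM ⟨n, rfl⟩⟩
  obtain ⟨M, hM⟩ := hbdd
  have heq : ∀ t ∈ Set.Ioo (0 : ℝ) 1, ∑' n, coeff n (bchSeries x y b b') * t ^ n =
      (Real.exp (x * t) * expQuot (y * t) * b' + expQuot (x * t) * b) / expQuot ((x + y) * t) := by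
    intro t ht
    have hs : Summable fun n => ‖coeff n (bchSeries x y b b') * t ^ n‖ := by
      refine ((summable_geometric_of_lt_one ht.1.le ht.2).mul_left M).of_nonneg_of_le
        (fun _ => norm_nonneg _) fun n => ?_
      rw [norm_mul, norm_pow, Real.norm_of_nonneg ht.1.le]
      exact mul_le_mul_of_nonneg_right (hM n) (by have := ht.1; positivity)
    have hm := AbsHasSumAt.mul ⟨hs, hs.of_norm.hasSum⟩
      (absHasSumAt_rescale_expQuotSeries (x + y) t)
    rw [bchSeries_mul] at hm
    rw [eq_div_iff (expQuot_pos _).ne']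
    exact hm.2.unique (absHasSumAt_bchNum x y b b' t).2
  have hcont : Continuous expQuot :=
    continuous_iff_continuousAt.2 fun z => (analyticAt_expQuot z).continuousAt
  have hlim : Tendsto (fun t : ℝ => (Real.exp (x * t) * expQuot (y * t) * b' +
      expQuot (x * t) * b) / expQuot ((x + y) * t)) (𝓝[<] 1) (𝓝 (bchSum x y b b')) := by
    have hc : Continuous fun t : ℝ => (Real.exp (x * t) * expQuot (y * t) * b' +
        expQuot (x * t) * b) / expQuot ((x + y) * t) := by
      refine Continuous.div (by fun_prop) (by fun_prop) fun t => (expQuot_pos _).ne'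
    have := hc.tendsto 1
    simp only [mul_one] at this
    exact this.mono_left nhdsWithin_le_nhds
  refine tendsto_nhds_unique habel (hlim.congr' ?_)
  filter_upwards [Ioo_mem_nhdsLT (zero_lt_one' ℝ)] with t ht
  exact (heq t ht).symm

/-! ### Divergence from Bernoulli numbers -/

theorem bchSeries_zero_eq_rescale_bernoulli (s : ℝ) :
    bchSeries s 0 0 1 = rescale s (bernoulli'PowerSeries ℝ) := by
  have h1 : bernoulli'PowerSeries ℝ * expQuotSeries = exp ℝ := by
    have h := bernoulli'PowerSeries_mul_exp_sub_one ℝ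
    rw [← X_mul_expQuotSeries] at h
    refine mul_left_cancel₀ (X_ne_zero (R := ℝ)) ?_
    linear_combination h
  have h2 : rescale (0 : ℝ) expQuotSeries = 1 := by
    rw [rescale_zero_apply, constantCoeff_expQuotSeries, map_one]
  have h3 := rescale_expQuotSeries_mul_inv s
  rw [bchSeries, bchNum, h2, map_one, map_zero, mul_zero, add_zero, mul_one, mul_one, add_zero,
    ← h1, map_mul, mul_assoc, h3, mul_one]

/-- By Euler's formula the coefficient of index 2k is (2π)²ᵏ B₂ₖ/(2k)! = ±2ζ(2k), and ζ(2k) ≥ 1 by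
its first term. -/
theorem not_tendsto_coeff_bchSeries_zero :
    ¬ Tendsto (fun n => coeff n (bchSeries (2 * Real.pi) 0 0 1)) atTop (𝓝 0) := by
  intro h
  have h2 : ∀ k : ℕ, k ≠ 0 → 2 ≤ |coeff (2 * k) (bchSeries (2 * Real.pi) 0 0 1)| := by
    intro k hk
    have hz := hasSum_zeta_nat hk
    have h1 : (1 : ℝ) ≤ (-1 : ℝ) ^ (k + 1) * (2 : ℝ) ^ (2 * k - 1) * Real.pi ^ (2 * k) *
        bernoulli (2 * k) / (2 * k).factorial := by
      simpa using le_hasSum hz 1 fun n _ => by positivity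
    have h3 : coeff (2 * k) (bchSeries (2 * Real.pi) 0 0 1) = 2 * (-1 : ℝ) ^ (k + 1) *
        ((-1 : ℝ) ^ (k + 1) * (2 : ℝ) ^ (2 * k - 1) * Real.pi ^ (2 * k) *
        bernoulli (2 * k) / (2 * k).factorial) := by
      rw [bchSeries_zero_eq_rescale_bernoulli, coeff_rescale, bernoulli'PowerSeries, coeff_mk,
        ← bernoulli_eq_bernoulli'_of_ne_one (by omega), mul_pow]
      have h4 : (2 : ℝ) ^ (2 * k) = 2 * 2 ^ (2 * k - 1) := by
        rw [← pow_succ']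
        congr 1
        omega
      have h5 : (-1 : ℝ) ^ (k + 1) * (-1) ^ (k + 1) = 1 := by
        rw [← mul_pow]
        norm_num
      rw [h4]
      simp only [map_div₀, eq_ratCast, Rat.cast_natCast]
      linear_combination (-2 * 2 ^ (2 * k - 1) * Real.pi ^ (2 * k) * bernoulli (2 * k) /
        (2 * k).factorial) * h5
    rw [h3, abs_mul, abs_mul, abs_pow, abs_neg, abs_one, one_pow, mul_one, abs_two]
    linarith [le_abs_self ((-1 : ℝ) ^ (k + 1) * (2 : ℝ) ^ (2 * k - 1) * Real.pi ^ (2 * k) *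
        bernoulli (2 * k) / (2 * k).factorial)]
  have h3 : Tendsto (fun k : ℕ => |coeff (2 * k) (bchSeries (2 * Real.pi) 0 0 1)|) atTop (𝓝 0) := by
    have := (h.comp (tendsto_id.const_mul_atTop' (zero_lt_two' ℕ))).abs
    simpa using this
  have h4 := ge_of_tendsto h3 (eventually_ne_atTop 0 |>.mono h2)
  linarith

end Convergence

/-! ### The BCH series in `eggAlgebra` -/

section BCHMap

theorem map_rightNestedBracket {L L' : Type*} [LieRing L] [LieAlgebra ℝ L] [LieRing L']
    [LieAlgebra ℝ L'] (f : L →ₗ⁅ℝ⁆ L') (w : List L) :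
    f (rightNestedBracket w) = rightNestedBracket (w.map f) := by
  induction w with
  | nil => exact map_zero f
  | cons a w ih =>
    cases w with
    | nil => rfl
    | cons b w =>
      rw [rightNestedBracket, LieHom.map_lie, ih]
      rfl

theorem map_bchWord {L L' : Type*} (f : L → L') (X Y : L) {k : ℕ} (p : Fin k → ℕ × ℕ) :
    (bchWord X Y p).map f = bchWord (f X) (f Y) p := by
  simp [bchWord, List.map_flatten, List.map_ofFn, Function.comp_def]

theorem map_bchTerm {L L' : Type*} [LieRing L] [LieAlgebra ℝ L] [LieRing L']
    [LieAlgebra ℝ L'] (f : L →ₗ⁅ℝ⁆ L') (n : ℕ) (X Y : L) :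
    f (bchTerm n X Y) = bchTerm n (f X) (f Y) := by
  simp only [bchTerm, map_smul, map_sum, map_rightNestedBracket, map_bchWord]

theorem BCHConvergesTo.map {L L' : Type*} [LieRing L] [LieAlgebra ℝ L] [TopologicalSpace L]
    [LieRing L'] [LieAlgebra ℝ L'] [TopologicalSpace L'] (f : L →ₗ⁅ℝ⁆ L') (hf : Continuous f)
    {X Y S : L} (h : BCHConvergesTo X Y S) : BCHConvergesTo (f X) (f Y) (f S) := by
  have := (hf.tendsto S).comp h
  simpa only [BCHConvergesTo, Function.comp_def, map_sum, map_bchTerm] using this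

theorem sum_Icc_one_eq_sum_range {M : Type*} [AddCommMonoid M] (f : ℕ → M) (N : ℕ) :
    ∑ n ∈ Finset.Icc 1 N, f n = ∑ n ∈ Finset.range N, f (n + 1) := by
  induction N with
  | zero => simp
  | succ N ih => rw [Finset.sum_Icc_succ_top (by omega), Finset.sum_range_succ, ih]

theorem apply_sum_bchTerm {L : Type*} [LieRing L] [LieAlgebra ℝ L] {α β : L →ₗ[ℝ] ℝ} {c : ℝ}
    (hα : ∀ u v : L, α ⁅u, v⁆ = 0) (hβ : ∀ u v : L, β ⁅u, v⁆ = c * (α u * β v - β u * α v))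
    (X Y : L) (N : ℕ) :
    β (∑ n ∈ Finset.Icc 1 N, bchTerm n X Y) = ∑ n ∈ Finset.range N,
      PowerSeries.coeff n (bchSeries (c * α X) (c * α Y) (β X) (β Y)) := by
  rw [sum_Icc_one_eq_sum_range, map_sum]
  exact Finset.sum_congr rfl fun n _ => apply_bchTerm hα hβ X Y n

/-- The coordinate `b` of `a A + b B + c C`, as a linear form on all matrices. -/
noncomputable def matrixCoordB : Matrix (Fin 3) (Fin 3) ℝ →ₗ[ℝ] ℝ :=
  (-(2 * Real.pi)⁻¹) • Matrix.entryLinearMap ℝ ℝ 1 0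

/-- The coordinates of `a A + b B + c C`. -/
noncomputable def eggCoordLinear : eggAlgebra ≃ₗ[ℝ] ℝ × ℝ × ℝ where
  toFun X := (X.1 2 2, matrixCoordB X.1, -(X.1 2 0))
  map_add' X Y := by simp; ring
  map_smul' r X := by simp
  invFun v := ⟨v.1 • eggA + v.2.1 • eggB + v.2.2 • eggC,
    Submodule.mem_span_triple.2 ⟨v.1, v.2.1, v.2.2, rfl⟩⟩
  left_inv X := by
    obtain ⟨M, hM⟩ := X
    obtain ⟨a, b, c, rfl⟩ := Submodule.mem_span_triple.1 hM
    refine Subtype.ext ?_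
    have : Real.pi ≠ 0 := Real.pi_ne_zero
    ext i j
    fin_cases i <;> fin_cases j <;> simp [matrixCoordB, eggA, eggB, eggC]
    field_simp
  right_inv v := by
    have : Real.pi ≠ 0 := Real.pi_ne_zero
    refine Prod.ext ?_ (Prod.ext ?_ ?_) <;> simp [matrixCoordB, eggA, eggB, eggC]
    field_simp

noncomputable def eggCoord : eggAlgebra ≃L[ℝ] ℝ × ℝ × ℝ :=
  eggCoordLinear.toContinuousLinearEquiv

theorem eggCoord_lie (X Y : eggAlgebra) :
    eggCoord ⁅X, Y⁆ = (0, 2 * Real.pi * ((eggCoord X).1 * (eggCoord Y).2.1 -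
      (eggCoord X).2.1 * (eggCoord Y).1), (eggCoord X).1 * (eggCoord Y).2.2 -
      (eggCoord X).2.2 * (eggCoord Y).1) := by
  obtain ⟨u, rfl⟩ := eggCoord.symm.surjective X
  obtain ⟨v, rfl⟩ := eggCoord.symm.surjective Y
  simp only [ContinuousLinearEquiv.apply_symm_apply]
  have : Real.pi ≠ 0 := Real.pi_ne_zero
  change (⁅(eggCoord.symm u).1, (eggCoord.symm v).1⁆ 2 2,
    matrixCoordB ⁅(eggCoord.symm u).1, (eggCoord.symm v).1⁆,
    -(⁅(eggCoord.symm u).1, (eggCoord.symm v).1⁆ 2 0)) = _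
  have h : ∀ u, (eggCoord.symm u).1 = u.1 • eggA + u.2.1 • eggB + u.2.2 • eggC := fun _ => rfl
  simp only [h, Ring.lie_def]
  refine Prod.ext ?_ (Prod.ext ?_ ?_) <;>
    simp [matrixCoordB, eggA, eggB, eggC]
  · ring
  · field_simp
    ring
  · ring

noncomputable def eggCoordA : eggAlgebra →ₗ[ℝ] ℝ :=
  LinearMap.fst ℝ ℝ (ℝ × ℝ) ∘ₗ eggCoord.toLinearMap

noncomputable def eggCoordB : eggAlgebra →ₗ[ℝ] ℝ :=
  LinearMap.fst ℝ ℝ ℝ ∘ₗ LinearMap.snd ℝ ℝ (ℝ × ℝ) ∘ₗ eggCoord.toLinearMap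

noncomputable def eggCoordC : eggAlgebra →ₗ[ℝ] ℝ :=
  LinearMap.snd ℝ ℝ ℝ ∘ₗ LinearMap.snd ℝ ℝ (ℝ × ℝ) ∘ₗ eggCoord.toLinearMap

theorem eggCoordA_lie (X Y : eggAlgebra) : eggCoordA ⁅X, Y⁆ = 0 :=
  congrArg Prod.fst (eggCoord_lie X Y)

theorem eggCoordA_lie' (X Y : eggAlgebra) :
    eggCoordA ⁅X, Y⁆ = 0 * (eggCoordA X * eggCoordA Y - eggCoordA X * eggCoordA Y) := by
  rw [eggCoordA_lie, zero_mul]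

theorem eggCoordB_lie (X Y : eggAlgebra) :
    eggCoordB ⁅X, Y⁆ =
      (2 * Real.pi) * (eggCoordA X * eggCoordB Y - eggCoordB X * eggCoordA Y) :=
  congrArg (fun v => v.2.1) (eggCoord_lie X Y)

theorem eggCoordC_lie (X Y : eggAlgebra) :
    eggCoordC ⁅X, Y⁆ = 1 * (eggCoordA X * eggCoordC Y - eggCoordC X * eggCoordA Y) := by
  rw [one_mul]
  exact congrArg (fun v => v.2.2) (eggCoord_lie X Y)

theorem bchConvergesTo_iff (X Y S : eggAlgebra) :
    BCHConvergesTo X Y S ↔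
      (Tendsto (fun N => ∑ n ∈ Finset.range N, PowerSeries.coeff n (bchSeries (0 * eggCoordA X)
        (0 * eggCoordA Y) (eggCoordA X) (eggCoordA Y))) atTop (𝓝 (eggCoordA S))) ∧
      (Tendsto (fun N => ∑ n ∈ Finset.range N, PowerSeries.coeff n (bchSeries
        (2 * Real.pi * eggCoordA X) (2 * Real.pi * eggCoordA Y) (eggCoordB X) (eggCoordB Y)))
        atTop (𝓝 (eggCoordB S))) ∧
      Tendsto (fun N => ∑ n ∈ Finset.range N, PowerSeries.coeff n (bchSeries (1 * eggCoordA X)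
        (1 * eggCoordA Y) (eggCoordC X) (eggCoordC Y))) atTop (𝓝 (eggCoordC S)) := by
  simp only [← apply_sum_bchTerm eggCoordA_lie eggCoordA_lie',
    ← apply_sum_bchTerm eggCoordA_lie eggCoordB_lie,
    ← apply_sum_bchTerm eggCoordA_lie eggCoordC_lie]
  rw [BCHConvergesTo, eggCoord.toHomeomorph.isInducing.tendsto_nhds_iff, Prod.tendsto_iff,
    Prod.tendsto_iff]
  rfl

theorem eventually_bchConverges :
    ∀ᶠ p : eggAlgebra × eggAlgebra in 𝓝 0, BCHConverges p.1 p.2 := by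
  have hcont : ∀ c : ℝ, ∀ᶠ p : eggAlgebra × eggAlgebra in 𝓝 0,
      |c * eggCoordA p.1 + c * eggCoordA p.2| < 1 := by
    intro c
    have hA : Continuous eggCoordA := LinearMap.continuous_of_finiteDimensional _
    have h : Continuous fun p : eggAlgebra × eggAlgebra =>
        |c * eggCoordA p.1 + c * eggCoordA p.2| := by fun_prop
    refine h.continuousAt.eventually_lt continuousAt_const ?_
    simp
  filter_upwards [hcont 0, hcont (2 * Real.pi), hcont 1] with p h0 h1 h2
  have hs : ∀ {x y : ℝ}, |x + y| < 1 → ∀ b b' : ℝ, ∃ l, Tendsto (fun N =>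
      ∑ n ∈ Finset.range N, PowerSeries.coeff n (bchSeries x y b b')) atTop (𝓝 l) :=
    fun h b b' => ⟨_, (summable_coeff_bchSeries h b b').hasSum.tendsto_sum_nat⟩
  obtain ⟨u, hu⟩ := hs h0 (eggCoordA p.1) (eggCoordA p.2)
  obtain ⟨v, hv⟩ := hs h1 (eggCoordB p.1) (eggCoordB p.2)
  obtain ⟨w, hw⟩ := hs h2 (eggCoordC p.1) (eggCoordC p.2)
  have h := eggCoord.apply_symm_apply (u, v, w)
  have hA : eggCoordA (eggCoord.symm (u, v, w)) = u := congrArg Prod.fst h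
  have hB : eggCoordB (eggCoord.symm (u, v, w)) = v := congrArg (fun z => z.2.1) h
  have hC : eggCoordC (eggCoord.symm (u, v, w)) = w := congrArg (fun z => z.2.2) h
  refine ⟨eggCoord.symm (u, v, w), (bchConvergesTo_iff _ _ _).2 ?_⟩
  rw [hA, hB, hC]
  exact ⟨hu, hv, hw⟩

/-- The analytic prolongation of the sum of the BCH series. -/
noncomputable def eggBCH (p : eggAlgebra × eggAlgebra) : eggAlgebra :=
  eggCoord.symm
    (bchSum (0 * eggCoordA p.1) (0 * eggCoordA p.2) (eggCoordA p.1) (eggCoordA p.2),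
      bchSum (2 * Real.pi * eggCoordA p.1) (2 * Real.pi * eggCoordA p.2) (eggCoordB p.1)
        (eggCoordB p.2),
      bchSum (1 * eggCoordA p.1) (1 * eggCoordA p.2) (eggCoordC p.1) (eggCoordC p.2))

theorem eggBCH_eq {X Y S : eggAlgebra} (h : BCHConvergesTo X Y S) : eggBCH (X, Y) = S := by
  obtain ⟨hA, hB, hC⟩ := (bchConvergesTo_iff X Y S).1 h
  rw [eggBCH, ContinuousLinearEquiv.symm_apply_eq]
  exact (Prod.ext (eq_bchSum_of_tendsto hA)
    (Prod.ext (eq_bchSum_of_tendsto hB) (eq_bchSum_of_tendsto hC))).symm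

theorem AnalyticAt.bchSum {E : Type*} [NormedAddCommGroup E] [NormedSpace ℝ E]
    {x y b b' : E → ℝ} {p : E} (hx : AnalyticAt ℝ x p) (hy : AnalyticAt ℝ y p)
    (hb : AnalyticAt ℝ b p) (hb' : AnalyticAt ℝ b' p) :
    AnalyticAt ℝ (fun q => bchSum (x q) (y q) (b q) (b' q)) p := by
  have h : ∀ {f : E → ℝ}, AnalyticAt ℝ f p → AnalyticAt ℝ (fun q => expQuot (f q)) p :=
    fun hf => (analyticAt_expQuot _).comp hf
  exact (((hx.rexp.mul (h hy)).mul hb').add ((h hx).mul hb)).div (h (hx.add hy))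
    (expQuot_pos _).ne'

theorem analyticOnNhd_eggBCH : AnalyticOnNhd ℝ eggBCH Set.univ := by
  intro p _
  have h1 : ∀ f : eggAlgebra →ₗ[ℝ] ℝ,
      AnalyticAt ℝ (fun q : eggAlgebra × eggAlgebra => f q.1) p := fun f =>
    (f.toContinuousLinearMap.comp (ContinuousLinearMap.fst ℝ eggAlgebra eggAlgebra)).analyticAt p
  have h2 : ∀ f : eggAlgebra →ₗ[ℝ] ℝ,
      AnalyticAt ℝ (fun q : eggAlgebra × eggAlgebra => f q.2) p := fun f =>
    (f.toContinuousLinearMap.comp (ContinuousLinearMap.snd ℝ eggAlgebra eggAlgebra)).analyticAt p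
  have h3 : ∀ (c : ℝ) (f : eggAlgebra →ₗ[ℝ] ℝ), AnalyticAt ℝ (fun q : eggAlgebra × eggAlgebra =>
      _root_.bchSum (c * eggCoordA q.1) (c * eggCoordA q.2) (f q.1) (f q.2)) p := fun c f =>
    AnalyticAt.bchSum (analyticAt_const.mul (h1 _)) (analyticAt_const.mul (h2 _)) (h1 f) (h2 f)
  exact (eggCoord.symm.toContinuousLinearMap.analyticAt _).comp
    ((h3 0 eggCoordA).prod ((h3 (2 * Real.pi) eggCoordB).prod (h3 1 eggCoordC)))

/-- `matrixCoordB` is defined and continuous on all of M₃(ℝ), so convergence there would already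
force its scalar terms to tend to 0. -/
theorem not_bchConverges_eggA_eggB : ¬ BCHConverges eggA eggB := by
  rintro ⟨S, hS⟩
  have hcont : Continuous matrixCoordB := LinearMap.continuous_of_finiteDimensional _
  have h1 := (hcont.tendsto S).comp hS
  have hA : eggCoord eggA' = (1, 0, 0) := by
    refine Prod.ext ?_ (Prod.ext ?_ ?_)
    · change eggA 2 2 = 1
      simp [eggA]
    · change matrixCoordB eggA = 0
      simp [matrixCoordB, eggA]
    · change -(eggA 2 0) = 0
      simp [eggA]
  have hB : eggCoord eggB' = (0, 1, 0) := by
    refine Prod.ext ?_ (Prod.ext ?_ ?_)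
    · change eggB 2 2 = 0
      simp [eggB]
    · have : Real.pi ≠ 0 := Real.pi_ne_zero
      change matrixCoordB eggB = 1
      simp [matrixCoordB, eggB]
      field_simp
    · change -(eggB 2 0) = 0
      simp [eggB]
  have h2 : ∀ n, matrixCoordB (bchTerm n eggA eggB) = eggCoordB (bchTerm n eggA' eggB') := by
    intro n
    exact congrArg matrixCoordB (map_bchTerm eggAlgebra.incl n eggA' eggB').symm
  have h3 : ∀ n, eggCoordB (bchTerm (n + 1) eggA' eggB') =
      PowerSeries.coeff n (bchSeries (2 * Real.pi) 0 0 1) := by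
    intro n
    rw [apply_bchTerm eggCoordA_lie eggCoordB_lie]
    have e1 : eggCoordA eggA' = 1 := congrArg Prod.fst hA
    have e2 : eggCoordA eggB' = 0 := congrArg Prod.fst hB
    have e3 : eggCoordB eggA' = 0 := congrArg (fun v => v.2.1) hA
    have e4 : eggCoordB eggB' = 1 := congrArg (fun v => v.2.1) hB
    rw [e1, e2, e3, e4, mul_one, mul_zero]
  simp only [Function.comp_def, sum_Icc_one_eq_sum_range, map_sum, h2, h3] at h1
  refine not_tendsto_coeff_bchSeries_zero ?_
  have := (h1.comp (tendsto_add_atTop_nat 1)).sub h1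
  simpa [Finset.sum_range_succ] using this

theorem not_bchConverges_eggA'_eggB' : ¬ BCHConverges eggA' eggB' := fun ⟨S, hS⟩ =>
  not_bchConverges_eggA_eggB ⟨S.1, hS.map eggAlgebra.incl continuous_subtype_val⟩

end BCHMap

/-! ### The Lie group -/

section EggGroupLie

open VectorField

theorem simplyConnectedSpace_eggGroup : SimplyConnectedSpace EggGroup :=
  inferInstanceAs (SimplyConnectedSpace (ℝ × ℝ × ℝ))

/-- The differential of the left translation by `g`. -/
noncomputable def eggLeftDeriv (g : ℝ × ℝ × ℝ) : ℝ × ℝ × ℝ →L[ℝ] ℝ × ℝ × ℝ :=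
  (ContinuousLinearMap.fst ℝ ℝ (ℝ × ℝ)).prod
    ((Real.exp (2 * Real.pi * g.1) •
        (ContinuousLinearMap.fst ℝ ℝ ℝ ∘L ContinuousLinearMap.snd ℝ ℝ (ℝ × ℝ))).prod
      (Real.exp g.1 • (ContinuousLinearMap.snd ℝ ℝ ℝ ∘L ContinuousLinearMap.snd ℝ ℝ (ℝ × ℝ))))

theorem hasFDerivAt_mulFun (g x : ℝ × ℝ × ℝ) :
    HasFDerivAt (EggGroup.mulFun g) (eggLeftDeriv g) x := by
  have h : EggGroup.mulFun g = fun x => (g.1, g.2.1, g.2.2) + eggLeftDeriv g x := by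
    ext x <;> simp [EggGroup.mulFun, eggLeftDeriv]
  rw [h]
  exact (eggLeftDeriv g).hasFDerivAt.const_add _

/-- The left-invariant vector field with value `v` at the identity. -/
noncomputable def eggField (v g : ℝ × ℝ × ℝ) : ℝ × ℝ × ℝ :=
  (v.1, Real.exp (2 * Real.pi * g.1) * v.2.1, Real.exp g.1 * v.2.2)

theorem mulInvariantVectorField_eq
    (v : GroupLieAlgebra 𝓘(ℝ, ℝ × ℝ × ℝ) EggGroup) (g : EggGroup) :
    mulInvariantVectorField v g = eggField v g := by
  have h : HasMFDerivAt 𝓘(ℝ, ℝ × ℝ × ℝ) 𝓘(ℝ, ℝ × ℝ × ℝ) (EggGroup.mulFun g) (0 : ℝ × ℝ × ℝ)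
      (eggLeftDeriv g) := (hasFDerivAt_mulFun g 0).hasMFDerivAt
  have h2 : mfderiv 𝓘(ℝ, ℝ × ℝ × ℝ) 𝓘(ℝ, ℝ × ℝ × ℝ) (fun x : EggGroup => g * x) (1 : EggGroup) =
      eggLeftDeriv g := h.mfderiv
  rw [mulInvariantVectorField, h2]
  rfl

theorem hasFDerivAt_eggField (v : ℝ × ℝ × ℝ) :
    HasFDerivAt (eggField v) ((0 : ℝ × ℝ × ℝ →L[ℝ] ℝ).prod
      (((2 * Real.pi * v.2.1) • ContinuousLinearMap.fst ℝ ℝ (ℝ × ℝ)).prod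
        (v.2.2 • ContinuousLinearMap.fst ℝ ℝ (ℝ × ℝ)))) 0 := by
  have h1 : HasFDerivAt (fun g : ℝ × ℝ × ℝ => g.1) (ContinuousLinearMap.fst ℝ ℝ (ℝ × ℝ)) 0 :=
    hasFDerivAt_fst
  have h2 := ((h1.const_mul (2 * Real.pi)).exp).mul_const v.2.1
  have h3 := h1.exp.mul_const v.2.2
  have h := (hasFDerivAt_const v.1 (0 : ℝ × ℝ × ℝ)).prodMk (h2.prodMk h3)
  refine h.congr_fderiv ?_
  ext <;> simp
  ring

theorem lieBracket_eggField (v w : ℝ × ℝ × ℝ) :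
    lieBracket ℝ (eggField v) (eggField w) 0 =
      (0, 2 * Real.pi * (v.1 * w.2.1 - v.2.1 * w.1), v.1 * w.2.2 - v.2.2 * w.1) := by
  simp only [lieBracket_eq]
  rw [(hasFDerivAt_eggField v).fderiv, (hasFDerivAt_eggField w).fderiv]
  ext <;> simp [eggField] <;> ring

theorem mlieBracket_eggField (v w : ℝ × ℝ × ℝ) :
    mlieBracket (M := ℝ × ℝ × ℝ) 𝓘(ℝ, ℝ × ℝ × ℝ) (eggField v) (eggField w) =
      lieBracket ℝ (eggField v) (eggField w) :=
  mlieBracketWithin_univ.symm.trans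
    (mlieBracketWithin_eq_lieBracketWithin.trans lieBracketWithin_univ)

theorem groupLieAlgebra_bracket (v w : GroupLieAlgebra 𝓘(ℝ, ℝ × ℝ × ℝ) EggGroup) :
    ⁅v, w⁆ = lieBracket ℝ (eggField v) (eggField w) 0 := by
  rw [GroupLieAlgebra.bracket_def]
  have h : ∀ v : GroupLieAlgebra 𝓘(ℝ, ℝ × ℝ × ℝ) EggGroup,
      mulInvariantVectorField v = eggField v := fun v => funext (mulInvariantVectorField_eq v)
  rw [h, h]
  exact congrFun (mlieBracket_eggField v w) (0 : ℝ × ℝ × ℝ)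

noncomputable def eggLieEquiv :
    eggAlgebra ≃ₗ⁅ℝ⁆ GroupLieAlgebra 𝓘(ℝ, ℝ × ℝ × ℝ) EggGroup :=
  { eggCoord.toLinearEquiv with
    map_lie' := by
      intro X Y
      exact (eggCoord_lie X Y).trans ((lieBracket_eggField _ _).symm.trans
        (groupLieAlgebra_bracket _ _).symm) }

/-! ### The exponential map of the group -/

/-- The exponential map in coordinates. -/
noncomputable def eggExp (v : ℝ × ℝ × ℝ) : ℝ × ℝ × ℝ :=
  (v.1, v.2.1 * expQuot (2 * Real.pi * v.1), v.2.2 * expQuot v.1)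

noncomputable def eggLog (v : ℝ × ℝ × ℝ) : ℝ × ℝ × ℝ :=
  (v.1, v.2.1 / expQuot (2 * Real.pi * v.1), v.2.2 / expQuot v.1)

theorem eggLog_eggExp (v : ℝ × ℝ × ℝ) : eggLog (eggExp v) = v := by
  simp [eggLog, eggExp, (expQuot_pos _).ne']

theorem eggExp_eggLog (v : ℝ × ℝ × ℝ) : eggExp (eggLog v) = v := by
  simp [eggLog, eggExp, (expQuot_pos _).ne']

theorem contDiff_expQuot {n : WithTop ℕ∞} : ContDiff ℝ n expQuot :=
  AnalyticOnNhd.contDiff fun z _ => analyticAt_expQuot z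

theorem contDiff_eggExp : ContDiff ℝ ω eggExp := by
  have h := contDiff_expQuot (n := ω)
  unfold eggExp
  fun_prop

theorem contDiff_eggLog : ContDiff ℝ ω eggLog := by
  have h := contDiff_expQuot (n := ω)
  have h1 : ContDiff ℝ ω fun v : ℝ × ℝ × ℝ => expQuot (2 * Real.pi * v.1) := by fun_prop
  have h2 : ContDiff ℝ ω fun v : ℝ × ℝ × ℝ => expQuot v.1 := by fun_prop
  exact contDiff_fst.prodMk (((contDiff_fst.comp contDiff_snd).div h1 fun _ => (expQuot_pos _).ne').prodMk
    ((contDiff_snd.comp contDiff_snd).div h2 fun _ => (expQuot_pos _).ne'))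

/-- For a ≠ 0 the function is b (eᵃᵗ - 1)/a. It solves the coordinate equations of the
left-invariant flow, whose first coordinate is linear in time. -/
theorem hasDerivAt_mul_expQuot (a b t : ℝ) :
    HasDerivAt (fun t => t * b * expQuot (a * t)) (Real.exp (a * t) * b) t := by
  rcases eq_or_ne a 0 with rfl | ha
  · simpa [expQuot_zero] using (hasDerivAt_id t).mul_const b
  · have h : (fun t => t * b * expQuot (a * t)) = fun t => (Real.exp (a * t) - 1) * (b / a) := by
      ext t
      rw [← mul_expQuot]
      field_simp
    rw [h]
    have h1 := ((((hasDerivAt_id t).const_mul a).exp).sub_const 1).mul_const (b / a)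
    refine h1.congr_deriv ?_
    simp only [id]
    field_simp

theorem hasDerivAt_eggExp_smul (v : ℝ × ℝ × ℝ) (t : ℝ) :
    HasDerivAt (fun t : ℝ => eggExp (t • v)) (eggField v (eggExp (t • v))) t := by
  have h1 : HasDerivAt (fun t : ℝ => t * v.1) v.1 t := by
    simpa using (hasDerivAt_id t).mul_const v.1
  have h2 := hasDerivAt_mul_expQuot (2 * Real.pi * v.1) v.2.1 t
  have h3 := hasDerivAt_mul_expQuot v.1 v.2.2 t
  have h := h1.prodMk (h2.prodMk h3)
  convert! h using 1
  · ext t <;> simp [eggExp] <;> left <;> congr 1 <;> ring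
  · simp only [eggField, eggExp, Prod.smul_fst, smul_eq_mul]
    congr 3 <;> congr 1 <;> ring

theorem isLieGroupExp_eggExp :
    IsLieGroupExp (I := 𝓘(ℝ, ℝ × ℝ × ℝ)) (G := EggGroup) eggExp := by
  intro (v : ℝ × ℝ × ℝ)
  refine ⟨fun t : ℝ => eggExp (t • v), fun t => ?_, ?_, ?_⟩
  · exact ((hasDerivAt_eggExp_smul v t).congr_deriv
      (mulInvariantVectorField_eq v (eggExp (t • v))).symm).hasFDerivAt.hasMFDerivAt
  · change eggExp ((0 : ℝ) • v) = (0, 0, 0)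
    simp [eggExp]
  · change eggExp ((1 : ℝ) • v) = eggExp v
    rw [one_smul]

noncomputable def eggExpDiffeomorph :
    Diffeomorph 𝓘(ℝ, eggAlgebra) 𝓘(ℝ, ℝ × ℝ × ℝ) eggAlgebra EggGroup ω where
  toFun X := eggExp (eggCoord X)
  invFun g := eggCoord.symm (eggLog g)
  left_inv X := by
    change eggCoord.symm (eggLog (eggExp (eggCoord X))) = X
    rw [eggLog_eggExp, ContinuousLinearEquiv.symm_apply_apply]
  right_inv (g : ℝ × ℝ × ℝ) := by
    change eggExp (eggCoord (eggCoord.symm (eggLog g))) = g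
    rw [ContinuousLinearEquiv.apply_symm_apply, eggExp_eggLog]
  contMDiff_toFun := by
    have h : ContMDiff 𝓘(ℝ, eggAlgebra) 𝓘(ℝ, ℝ × ℝ × ℝ) ω fun X => eggExp (eggCoord X) :=
      (contDiff_eggExp.comp eggCoord.contDiff).contMDiff
    exact h
  contMDiff_invFun := by
    have h : ContMDiff 𝓘(ℝ, ℝ × ℝ × ℝ) 𝓘(ℝ, eggAlgebra) ω fun g => eggCoord.symm (eggLog g) :=
      (eggCoord.symm.contDiff.comp contDiff_eggLog).contMDiff
    exact h

end EggGroupLie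

/-- `eggAlgebra` is the Lie subalgebra `span {A, B, C}` of `M₃(ℝ)`, with the norm inherited from
`M₃(ℝ)`. -/
theorem mainTheorem5 :
    -- the commutator relations
    (⁅eggA, eggB⁆ = (2 * Real.pi) • eggB ∧ ⁅eggA, eggC⁆ = eggC ∧ ⁅eggB, eggC⁆ = 0) ∧
    -- `EggGroup` is a simply connected Lie group whose Lie algebra is (isomorphic to) `eggAlgebra`,
    -- and its exponential map is a global analytic diffeomorphism
    (SimplyConnectedSpace EggGroup ∧
      ∃ (φ : eggAlgebra ≃ₗ⁅ℝ⁆ GroupLieAlgebra 𝓘(ℝ, ℝ × ℝ × ℝ) EggGroup)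
        (e : GroupLieAlgebra 𝓘(ℝ, ℝ × ℝ × ℝ) EggGroup → EggGroup),
        IsLieGroupExp e ∧
        ∃ Φ : Diffeomorph 𝓘(ℝ, eggAlgebra) 𝓘(ℝ, ℝ × ℝ × ℝ) eggAlgebra EggGroup ω,
          ∀ X, Φ X = e (φ X)) ∧
    -- the BCH series converges on a neighbourhood of the origin
    (∀ᶠ p : eggAlgebra × eggAlgebra in 𝓝 0, BCHConverges p.1 p.2) ∧
    -- the BCH map has an analytic prolongation to the whole of `eggAlgebra × eggAlgebra`
    (∃ P : eggAlgebra × eggAlgebra → eggAlgebra,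
      AnalyticOnNhd ℝ P Set.univ ∧
      ∀ X Y S : eggAlgebra, BCHConvergesTo X Y S → P (X, Y) = S) ∧
    -- the BCH series at `(A, B)` does not converge, neither in `eggAlgebra` nor in `M₃(ℝ)`
    (¬ BCHConverges eggA' eggB' ∧ ¬ BCHConverges eggA eggB) :=
  ⟨⟨lie_eggA_eggB, lie_eggA_eggC, lie_eggB_eggC⟩,
    ⟨simplyConnectedSpace_eggGroup, eggLieEquiv, eggExp, isLieGroupExp_eggExp, eggExpDiffeomorph,
      fun _ => rfl⟩,
    eventually_bchConverges, ⟨eggBCH, analyticOnNhd_eggBCH, fun _ _ _ => eggBCH_eq⟩,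
    not_bchConverges_eggA'_eggB', not_bchConverges_eggA_eggB⟩
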